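/- Let $k\ge 1$ be a fixed integer. For a word $w=a_1a_2\cdots a_n$ let $w^r=a_n\cdots a_2a_1$ denote its reversal. It is undecidable, given a context-free language $L$ over a finite alphabet $\Sigma$ (presented by a context-free grammar; the alphabet is not fixed but is part of the input), whether $L$ contains a word of the form $$w_1w_1^r\,w_2w_2^r\cdots w_kw_k^r$$ for some words $w_1,\dots,w_k\in\Sigma^*$ (empty words allowed). That is, for no $k\ge 1$ is there an algorithm that, for every context-free grammar given as input, decides correctly whether the language it generates contains such a word. -/

import Mathlib

/-- A finite presentation of a context-free grammar, as the input of an algorithm: the start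
symbol and the finite list of productions `A → α`. Terminals (letters) and nonterminals are named
by natural numbers; in a right-hand side `α`, `Sum.inl a` is the terminal `a` and `Sum.inr A` is
the nonterminal `A`. Only finitely many symbols occur in a presentation, so each one is a grammar
over a finite alphabet, and up to renaming of symbols every context-free grammar over a finite
alphabet is obtained. -/
abbrev CFGCode : Type := ℕ × List (ℕ × List (ℕ ⊕ ℕ))

namespace CFGCode

/-- The production `A → α` given by a pair `(A, α)`. -/
def toRule (p : ℕ × List (ℕ ⊕ ℕ)) : ContextFreeRule ℕ ℕ where
  input := p.1
  output := p.2.map (Sum.elim Symbol.terminal Symbol.nonterminal)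

/-- The context-free grammar presented by a code. -/
def toGrammar (G : CFGCode) : ContextFreeGrammar ℕ where
  NT := ℕ
  initial := G.1
  rules := (G.2.map toRule).toFinset

theorem mem_toGrammar_rules (G : CFGCode) (r : ContextFreeRule ℕ ℕ) :
    r ∈ G.toGrammar.rules ↔ ∃ p ∈ G.2, toRule p = r := by
  change r ∈ (G.2.map toRule).toFinset ↔ _
  rw [List.mem_toFinset, List.mem_map]

/-- The context-free language presented by a code: the words of terminals that its grammar
generates. -/
def language (G : CFGCode) : Language ℕ := G.toGrammar.language

end CFGCode

/-- The word `w₁ w₁ʳ w₂ w₂ʳ ⋯ wₖ wₖʳ` for a family `w` of `k` words. -/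
def mirrorPowers {α : Type*} {k : ℕ} (w : Fin k → List α) : List α :=
  (List.ofFn fun i => w i ++ (w i).reverse).flatten

/-- `L` contains a word of the form `w₁ w₁ʳ ⋯ wₖ wₖʳ`, for arbitrary, possibly empty, words `wᵢ`. -/
def ContainsMirrorPowers {α : Type*} (k : ℕ) (L : Language α) : Prop :=
  ∃ w : Fin k → List α, mirrorPowers w ∈ L

/-! ### Products of even palindromes -/

/-! The halting problem reduces to the question. Write a computation as a sequence of lines, each
obtained from the previous one by a local rewriting. A linear grammar generates the words `X 1 1
Yʳ`, where `X` lists lines, each terminated by `0` and the last one final, and `Y` lists one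
successor of every line but the last (`Trace`). Consecutive lines of `X` need not be related: each
line is only matched with its own successor, and these pairs are nested, so a linear grammar
suffices (`mem_grammar_language_iff`).

Append `0 wʳ`. The letter `1` occurs only at the two marks, so `X 1 1 Yʳ 0 wʳ` is an even palindrome
iff `X = w 0 Y`. This says that the first line is `w` and that each further line is the chosen
successor of the one before it, so `X` is an accepting run from `w`. For `k + 1` palindromes, the
word is prefixed by `d d` for `k` distinct fresh letters `d`; each such pair costs exactly one
factor (`flatMap_append_iff`), and one palindrome is left for the rest.

Acceptance of lines is undecidable because lines simulate stack machines: the stacks are written one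
after another between separators, tops next to the separators, so that every stack operation
replaces a factor of at most two letters. The machine of one universal code gives a fixed system,
and the program to be tested enters only through the initial line `w`. -/

/-- `w` is a product of `k` even palindromes. -/
def IsMirrorPower {α : Type*} (k : ℕ) (w : List α) : Prop :=
  ∃ f : Fin k → List α, mirrorPowers f = w

namespace IsMirrorPower

variable {α : Type*} {k : ℕ} {p w : List α} {d : α}

theorem zero_iff : IsMirrorPower 0 w ↔ w = [] := by
  simp [IsMirrorPower, mirrorPowers, eq_comm]

theorem succ_iff :
    IsMirrorPower (k + 1) w ↔ ∃ u v, w = u ++ u.reverse ++ v ∧ IsMirrorPower k v := by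
  constructor
  · rintro ⟨f, rfl⟩
    exact ⟨f 0, _, by simp [mirrorPowers, List.ofFn_succ], fun i => f i.succ, rfl⟩
  · rintro ⟨u, _, rfl, f, rfl⟩
    exact ⟨Fin.cons u f, by simp [mirrorPowers, List.ofFn_succ]⟩

theorem one_iff : IsMirrorPower 1 w ↔ ∃ u, w = u ++ u.reverse := by
  simp [succ_iff, zero_iff]

theorem succ (h : IsMirrorPower k w) : IsMirrorPower (k + 1) w :=
  succ_iff.2 ⟨[], w, by simp, h⟩

theorem cons_cons (d : α) (h : IsMirrorPower k p) : IsMirrorPower (k + 1) (d :: d :: p) :=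
  succ_iff.2 ⟨[d], p, by simp, h⟩

/-- A first factor `u uʳ` with `u` longer than one letter would end in a second `d` inside `p`. So
`u` is `d`, and the rest is `p`, or `u` is empty, and one of the remaining factors has to consume `d
d`; the wasted factor is then returned as an empty palindrome. -/
theorem of_cons_cons (hd : d ∉ p) (h : IsMirrorPower (k + 1) (d :: d :: p)) :
    IsMirrorPower k p := by
  induction k with
  | zero =>
    obtain ⟨u, hu⟩ := one_iff.1 h
    rcases u with _ | ⟨a, _ | ⟨b, u⟩⟩
    · simp at hu
    · simp_all [zero_iff]
    · simp only [List.cons_append, List.cons.injEq] at hu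
      obtain ⟨rfl, rfl, rfl⟩ := hu
      simp at hd
  | succ k ih =>
    obtain ⟨u, v, hu, hv⟩ := succ_iff.1 h
    rcases u with _ | ⟨a, _ | ⟨b, u⟩⟩
    · simp only [List.nil_append, List.reverse_nil] at hu
      exact (ih (hu ▸ hv)).succ
    · simp_all
    · simp only [List.cons_append, List.cons.injEq] at hu
      obtain ⟨rfl, rfl, rfl⟩ := hu
      simp at hd

theorem flatMap_append_iff {ds : List α} (hn : ds.Nodup) (hd : ∀ d ∈ ds, d ∉ p) :
    IsMirrorPower (ds.length + k) (ds.flatMap (fun d => [d, d]) ++ p) ↔ IsMirrorPower k p := by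
  induction ds with
  | nil => simp
  | cons d ds ih =>
    obtain ⟨hdn, hn⟩ := List.nodup_cons.1 hn
    rw [← ih hn fun e he => hd e (by simp [he]), List.length_cons, Nat.add_right_comm]
    refine ⟨fun h => h.of_cons_cons (d := d) ?_, fun h => h.cons_cons d⟩
    simp only [List.mem_append, List.mem_flatMap, not_or]
    refine ⟨?_, hd d (by simp)⟩
    rintro ⟨e, he, hde⟩
    simp only [List.mem_cons, List.not_mem_nil, or_self, or_false] at hde
    exact hdn (hde ▸ he)

end IsMirrorPower

theorem containsMirrorPowers_iff {α : Type*} {k : ℕ} {L : Language α} :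
    ContainsMirrorPowers k L ↔ ∃ w ∈ L, IsMirrorPower k w :=
  ⟨fun ⟨f, h⟩ => ⟨_, h, f, rfl⟩, fun ⟨_, h, f, e⟩ => ⟨f, e ▸ h⟩⟩

/-- The first occurrence of a letter determines the parts before and after it. -/
theorem List.append_cons_inj_left {α : Type*} {a : α} {x x' y y' : List α}
    (hx : a ∉ x) (hx' : a ∉ x') (h : x ++ a :: y = x' ++ a :: y') : x = x' ∧ y = y' := by
  induction x generalizing x' with
  | nil =>
    cases x' with
    | nil => simpa using h
    | cons c x' =>
      simp only [List.mem_cons, not_or, List.nil_append, List.cons_append, List.cons.injEq] at hx' h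
      exact absurd h.1 hx'.1
  | cons b x ih =>
    cases x' with
    | nil =>
      simp only [List.mem_cons, not_or, List.nil_append, List.cons_append, List.cons.injEq] at hx h
      exact absurd h.1.symm hx.1
    | cons c x' =>
      simp only [List.mem_cons, not_or, List.cons_append, List.cons.injEq] at hx hx' h ⊢
      obtain ⟨h1, h2⟩ := ih hx.2 hx'.2 h.2
      exact ⟨⟨h.1, h1⟩, h2⟩

/-- A word with exactly two marks, which are adjacent, is an even palindrome iff the part after
the marks is the reversal of the part before. -/
theorem exists_eq_append_reverse_iff {α : Type*} {a : α} {x z : List α} (hx : a ∉ x)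
    (hz : a ∉ z) : (∃ u, x ++ a :: a :: z = u ++ u.reverse) ↔ z = x.reverse := by
  constructor
  · rintro ⟨u, h⟩
    have hu : a ∈ u := by
      have : a ∈ x ++ a :: a :: z := by simp
      rw [h] at this
      simpa using this
    -- Cut `u` at its first mark, `u = s a t`, so that `u uʳ = s a t tʳ a sʳ`. Comparing first marks
    -- gives `x = s`; a nonempty `t` would push the last mark into `z`.
    obtain ⟨s, t, rfl, hs⟩ := List.eq_append_cons_of_mem hu
    simp only [List.reverse_append, List.reverse_cons, List.append_assoc, List.cons_append,
      List.nil_append] at h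
    obtain ⟨rfl, h⟩ := List.append_cons_inj_left hx hs h
    rcases t with _ | ⟨b, t⟩
    · simpa using h
    · simp only [List.cons_append, List.cons.injEq] at h
      exact absurd (by rw [h.2]; simp) hz
  · rintro rfl
    exact ⟨x ++ [a], by simp⟩

/-! ### Generated words of a grammar code -/

namespace CFGCode

/-- The sentential form given by the right-hand side of a production. -/
def body (α : List (ℕ ⊕ ℕ)) : List (Symbol ℕ ℕ) :=
  α.map (Sum.elim Symbol.terminal Symbol.nonterminal)

/-- The sentential form given by a terminal word. -/
def ofWord (w : List ℕ) : List (Symbol ℕ ℕ) := w.map Symbol.terminal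

theorem ofWord_append (v w : List ℕ) : ofWord (v ++ w) = ofWord v ++ ofWord w :=
  List.map_append

theorem body_terminal (w : List ℕ) : body (w.map Sum.inl) = ofWord w := by
  simp [body, ofWord, Function.comp_def]

theorem body_linear (x y : List ℕ) (M : ℕ) :
    body (x.map Sum.inl ++ Sum.inr M :: y.map Sum.inl) =
      ofWord x ++ [Symbol.nonterminal M] ++ ofWord y := by
  simp [body, ofWord, Function.comp_def]

/-- One rewriting step with a production of the code `G`. -/
def Rewrites (G : CFGCode) (v w : List (Symbol ℕ ℕ)) : Prop :=
  ∃ p ∈ G.2, ∃ s t, v = s ++ [Symbol.nonterminal p.1] ++ t ∧ w = s ++ body p.2 ++ t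

theorem Rewrites.append {G : CFGCode} {v w : List (Symbol ℕ ℕ)} (h : G.Rewrites v w)
    (x y : List (Symbol ℕ ℕ)) : G.Rewrites (x ++ v ++ y) (x ++ w ++ y) := by
  obtain ⟨p, hp, s, t, rfl, rfl⟩ := h
  exact ⟨p, hp, x ++ s, t ++ y, by simp, by simp⟩

/-- The terminal word `w` is derivable from the nonterminal `N`. -/
def Generates (G : CFGCode) (N : ℕ) (w : List ℕ) : Prop :=
  Relation.ReflTransGen G.Rewrites [Symbol.nonterminal N] (ofWord w)

theorem rewrites_iff_produces {G : CFGCode} {v w : List (Symbol ℕ ℕ)} :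
    G.Rewrites v w ↔ G.toGrammar.Produces v w := by
  constructor
  · rintro ⟨p, hp, s, t, rfl, rfl⟩
    exact ⟨toRule p, (G.mem_toGrammar_rules _).2 ⟨p, hp, rfl⟩,
      ContextFreeRule.rewrites_iff.2 ⟨s, t, rfl, rfl⟩⟩
  · rintro ⟨r, hr, hrw⟩
    obtain ⟨p, hp, rfl⟩ := (G.mem_toGrammar_rules r).1 hr
    obtain ⟨s, t, hv, hw⟩ := hrw.exists_parts
    exact ⟨p, hp, s, t, hv, hw⟩

theorem mem_language_iff {G : CFGCode} {w : List ℕ} : w ∈ G.language ↔ G.Generates G.1 w := by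
  have : G.Rewrites = G.toGrammar.Produces := by
    ext v w
    exact rewrites_iff_produces
  unfold Generates
  rw [this]
  rfl

theorem rewrites_of_mem {G : CFGCode} {N : ℕ} {α : List (ℕ ⊕ ℕ)} (h : (N, α) ∈ G.2) :
    G.Rewrites [Symbol.nonterminal N] (body α) :=
  ⟨_, h, [], [], by simp, by simp⟩

theorem generates_terminal {G : CFGCode} {N : ℕ} {w : List ℕ} (h : (N, w.map Sum.inl) ∈ G.2) :
    G.Generates N w :=
  .single (body_terminal w ▸ rewrites_of_mem h)

theorem generates_linear {G : CFGCode} {N M : ℕ} {x y z : List ℕ}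
    (h : (N, x.map Sum.inl ++ Sum.inr M :: y.map Sum.inl) ∈ G.2) (hz : G.Generates M z) :
    G.Generates N (x ++ z ++ y) := by
  refine .head (rewrites_of_mem h) ?_
  rw [body_linear, ofWord_append, ofWord_append]
  exact hz.lift (fun v => ofWord x ++ v ++ ofWord y) fun _ _ h => h.append _ _

/-- The language of a sentential form, for given languages of the nonterminals. -/
def interpret (I : ℕ → Language ℕ) (w : List (Symbol ℕ ℕ)) : Language ℕ :=
  (w.map fun
    | .terminal a => ({[a]} : Language ℕ)
    | .nonterminal N => I N).prod

theorem interpret_append (I : ℕ → Language ℕ) (v w : List (Symbol ℕ ℕ)) :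
    interpret I (v ++ w) = interpret I v * interpret I w := by
  simp [interpret]

theorem interpret_nonterminal (I : ℕ → Language ℕ) (N : ℕ) :
    interpret I [Symbol.nonterminal N] = I N := by
  simp [interpret]

theorem interpret_ofWord (I : ℕ → Language ℕ) (w : List ℕ) : interpret I (ofWord w) = {w} := by
  induction w with
  | nil => rfl
  | cons a w ih =>
    have : interpret I (ofWord (a :: w)) = {[a]} * interpret I (ofWord w) := by
      simp [interpret, ofWord]
    rw [this, ih]
    exact Set.image2_singleton

theorem mem_interpret_terminal {I : ℕ → Language ℕ} {x w : List ℕ} :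
    w ∈ interpret I (body (x.map Sum.inl)) ↔ w = x := by
  rw [body_terminal, interpret_ofWord]
  rfl

theorem mem_interpret_linear {I : ℕ → Language ℕ} {x y w : List ℕ} {M : ℕ} :
    w ∈ interpret I (body (x.map Sum.inl ++ Sum.inr M :: y.map Sum.inl)) ↔
      ∃ z ∈ I M, w = x ++ z ++ y := by
  rw [body_linear, interpret_append, interpret_append, interpret_ofWord, interpret_ofWord,
    interpret_nonterminal]
  simp only [Language.mem_mul]
  constructor
  · rintro ⟨_, ⟨_, rfl, z, hz, rfl⟩, _, rfl, rfl⟩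
    exact ⟨z, hz, rfl⟩
  · rintro ⟨z, hz, rfl⟩
    exact ⟨_, ⟨_, rfl, z, hz, rfl⟩, _, rfl, rfl⟩

/-- Languages of the nonterminals that are closed under the productions contain all generated
words. -/
theorem mem_of_generates {G : CFGCode} {I : ℕ → Language ℕ}
    (hI : ∀ p ∈ G.2, interpret I (body p.2) ≤ I p.1) {N : ℕ} {w : List ℕ}
    (h : G.Generates N w) : w ∈ I N := by
  -- Going backwards along the derivation, undoing a production can only enlarge the interpretation
  -- of the sentential form.
  have key : ∀ v, Relation.ReflTransGen G.Rewrites v (ofWord w) → w ∈ interpret I v := by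
    intro v hv
    induction hv using Relation.ReflTransGen.head_induction_on with
    | refl => rw [interpret_ofWord]; rfl
    | head hstep _ ih =>
      obtain ⟨p, hp, s, t, rfl, rfl⟩ := hstep
      rw [interpret_append, interpret_append] at ih ⊢
      rw [interpret_nonterminal]
      exact mul_le_mul' (mul_le_mul' le_rfl (hI p hp)) le_rfl ih
  exact interpret_nonterminal I N ▸ key _ h

end CFGCode

/-! ### Line rewriting systems and their grammars -/

/-- A finite line rewriting system. A line is a state letter followed by body letters. A rule
`(q, q', u, v)` replaces the state letter `q` by `q'` and one factor `u` of the body by `v`. -/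
structure LineSystem where
  /-- The letters of the bodies of lines. -/
  letters : List ℕ
  /-- The rules. -/
  rules : List (ℕ × ℕ × List ℕ × List ℕ)
  /-- The final states. -/
  finals : List ℕ

namespace LineSystem

variable {R : LineSystem}

/-- One application of a rule. -/
def Step (R : LineSystem) (w w' : List ℕ) : Prop :=
  ∃ q q' u v, (q, q', u, v) ∈ R.rules ∧ ∃ p s, p ⊆ R.letters ∧ s ⊆ R.letters ∧
    w = q :: (p ++ u ++ s) ∧ w' = q' :: (p ++ v ++ s)

/-- A final line can be reached from the line `w`. -/
def Accepts (R : LineSystem) (w : List ℕ) : Prop :=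
  ∃ h ∈ R.finals, ∃ s, s ⊆ R.letters ∧ Relation.ReflTransGen R.Step w (h :: s)

/-- `R.Trace X Y` holds if `X` is a sequence of lines, each terminated by the letter `0` and the
last one final, and `Y` consists of successors of all of them but the last. -/
inductive Trace (R : LineSystem) : List ℕ → List ℕ → Prop
  | final {h : ℕ} {s : List ℕ} (hh : h ∈ R.finals) (hs : s ⊆ R.letters) :
      Trace R (h :: (s ++ [0])) []
  | step {q q' : ℕ} {u v p s X Y : List ℕ} (hr : (q, q', u, v) ∈ R.rules) (hp : p ⊆ R.letters)
      (hs : s ⊆ R.letters) (hXY : Trace R X Y) :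
      Trace R (q :: (p ++ u ++ s ++ 0 :: X)) (q' :: (p ++ v ++ s ++ 0 :: Y))

/-- All letters of the system satisfy `P`. -/
structure LettersSatisfy (R : LineSystem) (P : ℕ → Prop) : Prop where
  letters : ∀ a ∈ R.letters, P a
  finals : ∀ a ∈ R.finals, P a
  rules : ∀ q q' u v, (q, q', u, v) ∈ R.rules → P q ∧ P q' ∧ (∀ a ∈ u, P a) ∧ ∀ a ∈ v, P a

theorem Trace.forall_mem {P : ℕ → Prop} (hP : R.LettersSatisfy P) (h0 : P 0) {X Y : List ℕ}
    (h : R.Trace X Y) : (∀ a ∈ X, P a) ∧ ∀ a ∈ Y, P a := by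
  induction h with
  | final hh hs =>
    have := hP.letters
    have := hP.finals _ hh
    simp only [List.mem_cons, List.mem_append, List.not_mem_nil]
    grind
  | step hr hp hs _ ih =>
    have := hP.letters
    have := hP.rules _ _ _ _ hr
    simp only [List.mem_cons, List.mem_append]
    grind

theorem Step.zero_notMem (hP : R.LettersSatisfy (· ≠ 0)) {w w' : List ℕ} (h : R.Step w w') :
    0 ∉ w' := by
  obtain ⟨q, q', u, v, hr, p, s, hp, hs, rfl, rfl⟩ := h
  have := hP.letters
  have := hP.rules _ _ _ _ hr
  simp only [List.mem_cons, List.mem_append]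
  grind

/-- The equation `X = w 0 Y` reproduces itself: comparing both sides up to the first `0` identifies
`w` with the first line of `X`, and what remains is the same equation for the shorter trace, with
the successor of `w` in place of `w`. -/
theorem accepts_of_trace (hP : R.LettersSatisfy (· ≠ 0)) {X Y w : List ℕ} (h : R.Trace X Y)
    (hw : 0 ∉ w) (hX : X = w ++ 0 :: Y) : R.Accepts w := by
  induction h generalizing w with
  | @final h s hh hs =>
    have h0 : 0 ∉ h :: s := by
      have := hP.letters
      have := hP.finals _ hh
      simp only [List.mem_cons]
      grind
    obtain ⟨rfl, -⟩ := List.append_cons_inj_left (x := h :: s) h0 hw (by simpa using hX)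
    exact ⟨h, hh, s, hs, .refl⟩
  | @step q q' u v p s X Y hr hp hs _ ih =>
    have h0 : 0 ∉ q :: (p ++ u ++ s) := by
      have := hP.letters
      have := hP.rules _ _ _ _ hr
      simp only [List.mem_cons, List.mem_append]
      grind
    obtain ⟨rfl, hX'⟩ := List.append_cons_inj_left (x := q :: (p ++ u ++ s)) h0 hw
      (by simpa using hX)
    have hstep : R.Step (q :: (p ++ u ++ s)) (q' :: (p ++ v ++ s)) :=
      ⟨q, q', u, v, hr, p, s, hp, hs, rfl, rfl⟩
    obtain ⟨h, hh, t, ht, hreach⟩ := ih (hstep.zero_notMem hP) (by simpa using hX')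
    exact ⟨h, hh, t, ht, .head hstep hreach⟩

/-- `Y` is the run without its first line. -/
theorem exists_trace_of_accepts {w : List ℕ} (h : R.Accepts w) :
    ∃ Y, R.Trace (w ++ 0 :: Y) Y := by
  obtain ⟨h, hh, s, hs, hreach⟩ := h
  induction hreach using Relation.ReflTransGen.head_induction_on with
  | refl => exact ⟨[], .final hh hs⟩
  | head hstep _ ih =>
    obtain ⟨q, q', u, v, hr, p, s, hp, hs, rfl, rfl⟩ := hstep
    obtain ⟨Y, hY⟩ := ih
    exact ⟨_, by simpa using Trace.step hr hp hs hY⟩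

/-- The name of the nonterminal that produces the part of a line before the factor to be
replaced. -/
def ruleNonterminal (u v : List ℕ) : ℕ := Encodable.encode (u, v) + 4

theorem ruleNonterminal_inj {u v u' v' : List ℕ} (h : ruleNonterminal u v = ruleNonterminal u' v') :
    u = u' ∧ v = v' := by
  have := Encodable.encode_injective (Nat.add_right_cancel h)
  simpa using this

/-- The production `N → x M y`. -/
def linearProduction (N : ℕ) (x : List ℕ) (M : ℕ) (y : List ℕ) : ℕ × List (ℕ ⊕ ℕ) :=
  (N, x.map Sum.inl ++ Sum.inr M :: y.map Sum.inl)

/-- The productions for the words `X 1 1 Yʳ` with `R.Trace X Y`. -/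
def productions (R : LineSystem) : List (ℕ × List (ℕ ⊕ ℕ)) :=
  -- Nonterminal `0` starts a line, `1` continues behind the replaced factor, `2` continues a final
  -- line, and `3` is the start symbol of `grammar`; the shift by 4 in `ruleNonterminal` keeps clear
  -- of these. The state letters are emitted together with the choice of the rule, so only `u` and
  -- `v` have to be remembered.
  [linearProduction 1 [0] 0 [0], (2, [0, 1, 1].map Sum.inl)] ++
  R.letters.map (fun a => linearProduction 1 [a] 1 [a]) ++
  R.letters.map (fun a => linearProduction 2 [a] 2 []) ++
  R.finals.map (fun h => linearProduction 0 [h] 2 []) ++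
  R.rules.map (fun r => linearProduction 0 [r.1] (ruleNonterminal r.2.2.1 r.2.2.2) [r.2.1]) ++
  R.rules.map (fun r =>
    linearProduction (ruleNonterminal r.2.2.1 r.2.2.2) r.2.2.1 1 r.2.2.2.reverse) ++
  R.rules.flatMap (fun r => R.letters.map fun a =>
    linearProduction (ruleNonterminal r.2.2.1 r.2.2.2) [a] (ruleNonterminal r.2.2.1 r.2.2.2) [a])

/-- The grammar for the words `x X 1 1 Yʳ y` with `R.Trace X Y`. -/
def grammar (R : LineSystem) (x y : List ℕ) : CFGCode :=
  (3, linearProduction 3 x 0 y :: R.productions)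

/-- The languages of the nonterminals of `R.grammar x y`. -/
def languages (R : LineSystem) (x y : List ℕ) : ℕ → Language ℕ
  | 0 => {w | ∃ X Y, R.Trace X Y ∧ w = X ++ 1 :: 1 :: Y.reverse}
  | 1 => {w | ∃ X Y s, R.Trace X Y ∧ s ⊆ R.letters ∧
      w = s ++ 0 :: X ++ 1 :: 1 :: Y.reverse ++ 0 :: s.reverse}
  | 2 => {w | ∃ s, s ⊆ R.letters ∧ w = s ++ [0, 1, 1]}
  | 3 => {w | ∃ X Y, R.Trace X Y ∧ w = x ++ X ++ 1 :: 1 :: Y.reverse ++ y}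
  | n + 4 => {w | ∃ X Y p s u v, R.Trace X Y ∧ p ⊆ R.letters ∧ s ⊆ R.letters ∧
      n + 4 = ruleNonterminal u v ∧
      w = p ++ u ++ s ++ 0 :: X ++ 1 :: 1 :: Y.reverse ++ 0 :: s.reverse ++ v.reverse ++ p.reverse}

theorem mem_languages_ruleNonterminal {x y u v w : List ℕ} :
    w ∈ R.languages x y (ruleNonterminal u v) ↔
      ∃ X Y p s, R.Trace X Y ∧ p ⊆ R.letters ∧ s ⊆ R.letters ∧
      w = p ++ u ++ s ++ 0 :: X ++ 1 :: 1 :: Y.reverse ++ 0 :: s.reverse ++ v.reverse ++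
        p.reverse := by
  change (∃ X Y p s u' v', _) ↔ _
  constructor
  · rintro ⟨X, Y, p, s, u', v', hXY, hp, hs, h, rfl⟩
    obtain ⟨rfl, rfl⟩ := ruleNonterminal_inj h
    exact ⟨X, Y, p, s, hXY, hp, hs, rfl⟩
  · rintro ⟨X, Y, p, s, hXY, hp, hs, rfl⟩
    exact ⟨X, Y, p, s, u, v, hXY, hp, hs, rfl, rfl⟩

/-! ### Soundness: the intended languages are closed under the productions -/

theorem interpret_linear_le {I : ℕ → Language ℕ} {N M : ℕ} {x y : List ℕ}
    (h : ∀ z ∈ I M, x ++ z ++ y ∈ I N) :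
    CFGCode.interpret I (CFGCode.body (linearProduction N x M y).2) ≤
      I (linearProduction N x M y).1 := by
  intro w hw
  obtain ⟨z, hz, rfl⟩ := CFGCode.mem_interpret_linear.1 hw
  exact h z hz

theorem interpret_productions_le (x y : List ℕ) :
    ∀ p ∈ (R.grammar x y).2, CFGCode.interpret (R.languages x y) (CFGCode.body p.2) ≤
      R.languages x y p.1 := by
  intro p hp
  simp only [grammar, productions, List.mem_cons, List.mem_append, List.mem_map,
    List.mem_flatMap, List.not_mem_nil, or_false] at hp
  rcases hp with rfl | (((((((rfl | rfl) | h) | h) | h) | h) | h) | h)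
  · refine interpret_linear_le ?_
    rintro z ⟨X, Y, h, rfl⟩
    exact ⟨X, Y, h, by simp⟩
  · refine interpret_linear_le ?_
    rintro z ⟨X, Y, h, rfl⟩
    exact ⟨X, Y, [], h, by simp, by simp⟩
  · intro w hw
    exact ⟨[], by simp, CFGCode.mem_interpret_terminal.1 hw⟩
  · obtain ⟨a, ha, rfl⟩ := h
    refine interpret_linear_le ?_
    rintro z ⟨X, Y, s, h, hs, rfl⟩
    exact ⟨X, Y, a :: s, h, List.cons_subset.2 ⟨ha, hs⟩, by simp⟩
  · obtain ⟨a, ha, rfl⟩ := h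
    refine interpret_linear_le ?_
    rintro z ⟨s, hs, rfl⟩
    exact ⟨a :: s, List.cons_subset.2 ⟨ha, hs⟩, by simp⟩
  · obtain ⟨a, ha, rfl⟩ := h
    refine interpret_linear_le ?_
    rintro z ⟨s, hs, rfl⟩
    exact ⟨_, _, .final ha hs, by simp⟩
  · obtain ⟨⟨q, q', u, v⟩, hr, rfl⟩ := h
    refine interpret_linear_le ?_
    intro z hz
    obtain ⟨X, Y, p, s, h, hp, hs, rfl⟩ := mem_languages_ruleNonterminal.1 hz
    exact ⟨_, _, .step hr hp hs h, by simp⟩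
  · obtain ⟨⟨q, q', u, v⟩, hr, rfl⟩ := h
    refine interpret_linear_le ?_
    rintro z ⟨X, Y, s, h, hs, rfl⟩
    exact mem_languages_ruleNonterminal.2 ⟨X, Y, [], s, h, by simp, hs, by simp⟩
  · obtain ⟨⟨q, q', u, v⟩, hr, a, ha, rfl⟩ := h
    refine interpret_linear_le ?_
    intro z hz
    obtain ⟨X, Y, p, s, h, hp, hs, rfl⟩ := mem_languages_ruleNonterminal.1 hz
    exact mem_languages_ruleNonterminal.2
      ⟨X, Y, a :: p, s, h, List.cons_subset.2 ⟨ha, hp⟩, hs, by simp⟩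

/-! ### Completeness: every trace is generated -/

section Generates

variable {x y : List ℕ}

theorem generates_of_mem_productions {N M : ℕ} {v w z : List ℕ}
    (h : linearProduction N v M w ∈ R.productions) (hz : (R.grammar x y).Generates M z) :
    (R.grammar x y).Generates N (v ++ z ++ w) :=
  CFGCode.generates_linear (List.mem_cons_of_mem _ h) hz

theorem generates_two {s : List ℕ} (hs : s ⊆ R.letters) :
    (R.grammar x y).Generates 2 (s ++ [0, 1, 1]) := by
  induction s with
  | nil => exact CFGCode.generates_terminal (by simp [grammar, productions])
  | cons a s ih =>
    have ha := hs (List.mem_cons_self ..)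
    have := generates_of_mem_productions (v := [a]) (w := []) (N := 2)
      (by
        simp only [productions, List.mem_append, List.mem_map]
        exact .inl (.inl (.inl (.inl (.inr ⟨a, ha, rfl⟩)))))
      (ih fun _ hb => hs (List.mem_cons_of_mem _ hb))
    simpa using this

theorem generates_one {s z : List ℕ} (hs : s ⊆ R.letters)
    (hz : (R.grammar x y).Generates 0 z) :
    (R.grammar x y).Generates 1 (s ++ 0 :: z ++ 0 :: s.reverse) := by
  induction s with
  | nil =>
    have := generates_of_mem_productions (v := [0]) (w := [0]) (N := 1)
      (by simp [productions]) hz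
    simpa using this
  | cons a s ih =>
    have ha := hs (List.mem_cons_self ..)
    have := generates_of_mem_productions (v := [a]) (w := [a]) (N := 1)
      (by
        simp only [productions, List.mem_append, List.mem_map]
        exact .inl (.inl (.inl (.inl (.inl (.inr ⟨a, ha, rfl⟩))))))
      (ih fun _ hb => hs (List.mem_cons_of_mem _ hb))
    simpa using this

theorem generates_ruleNonterminal {q q' : ℕ} {u v p z : List ℕ} (hr : (q, q', u, v) ∈ R.rules)
    (hp : p ⊆ R.letters) (hz : (R.grammar x y).Generates 1 z) :
    (R.grammar x y).Generates (ruleNonterminal u v)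
      (p ++ (u ++ z ++ v.reverse) ++ p.reverse) := by
  induction p with
  | nil =>
    have := generates_of_mem_productions (v := u) (w := v.reverse) (N := ruleNonterminal u v)
      (by
        simp only [productions, List.mem_append, List.mem_map]
        exact .inl (.inr ⟨_, hr, rfl⟩)) hz
    simpa using this
  | cons a p ih =>
    have ha := hp (List.mem_cons_self ..)
    have := generates_of_mem_productions (v := [a]) (w := [a]) (N := ruleNonterminal u v)
      (by
        simp only [productions, List.mem_append, List.mem_flatMap, List.mem_map]
        exact .inr ⟨_, hr, a, ha, rfl⟩)
      (ih fun _ hb => hp (List.mem_cons_of_mem _ hb))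
    simpa using this

theorem generates_zero {X Y : List ℕ} (h : R.Trace X Y) :
    (R.grammar x y).Generates 0 (X ++ 1 :: 1 :: Y.reverse) := by
  induction h with
  | @final h s hh hs =>
    have := generates_of_mem_productions (x := x) (y := y) (v := [h]) (w := []) (N := 0)
      (by
        simp only [productions, List.mem_append, List.mem_map]
        exact .inl (.inl (.inl (.inr ⟨h, hh, rfl⟩)))) (generates_two hs)
    simpa using this
  | @step q q' u v p s X Y hr hp hs _ ih =>
    have := generates_of_mem_productions (x := x) (y := y) (v := [q]) (w := [q']) (N := 0)
      (by
        simp only [productions, List.mem_append, List.mem_map]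
        exact .inl (.inl (.inr ⟨_, hr, rfl⟩)))
      (generates_ruleNonterminal hr hp (generates_one hs ih))
    simpa using this

end Generates

theorem mem_grammar_language_iff {x y w : List ℕ} :
    w ∈ (R.grammar x y).language ↔
      ∃ X Y, R.Trace X Y ∧ w = x ++ (X ++ 1 :: 1 :: Y.reverse) ++ y := by
  rw [CFGCode.mem_language_iff]
  constructor
  · intro h
    obtain ⟨X, Y, hXY, rfl⟩ := CFGCode.mem_of_generates (interpret_productions_le x y) h
    exact ⟨X, Y, hXY, by simp⟩
  · rintro ⟨X, Y, h, rfl⟩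
    exact CFGCode.generates_linear (List.mem_cons_self ..) (generates_zero h)

/-- The word `d d` for each of `k` consecutive letters `d`, starting with `D`. -/
def doubledLetters (D k : ℕ) : List ℕ :=
  (List.range' D k).flatMap fun d => [d, d]

/-- The letters of lines lie in `[2, D)`. This separates them from the terminator `0`, from the
central mark `1` and from the doubled letters, which start at `D`. -/
theorem containsMirrorPowers_grammar_iff {D k : ℕ} {w : List ℕ}
    (hP : R.LettersSatisfy fun a => 2 ≤ a ∧ a < D) (hD : 2 ≤ D) (hw : ∀ a ∈ w, 2 ≤ a ∧ a < D) :
    ContainsMirrorPowers (k + 1)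
      (R.grammar (doubledLetters D k) (0 :: w.reverse)).language ↔ R.Accepts w := by
  have hP0 : R.LettersSatisfy (· ≠ 0) :=
    ⟨fun a ha => by have := hP.letters a ha; omega, fun a ha => by have := hP.finals a ha; omega,
      fun q q' u v h => by have := hP.rules q q' u v h; grind⟩
  have hP1 : R.LettersSatisfy (· ≠ 1) :=
    ⟨fun a ha => by have := hP.letters a ha; omega, fun a ha => by have := hP.finals a ha; omega,
      fun q q' u v h => by have := hP.rules q q' u v h; grind⟩
  have hPD : R.LettersSatisfy (· < D) :=
    ⟨fun a ha => (hP.letters a ha).2, fun a ha => (hP.finals a ha).2,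
      fun q q' u v h => by have := hP.rules q q' u v h; grind⟩
  have key : ∀ {X Y}, R.Trace X Y →
      (IsMirrorPower (k + 1)
        (doubledLetters D k ++ (X ++ 1 :: 1 :: Y.reverse) ++ 0 :: w.reverse) ↔
          X = w ++ 0 :: Y) := by
    intro X Y h
    obtain ⟨hX1, hY1⟩ := h.forall_mem hP1 (by omega)
    obtain ⟨hXD, hYD⟩ := h.forall_mem hPD (by omega)
    have hlen : k + 1 = (List.range' D k).length + 1 := by simp
    rw [List.append_assoc, doubledLetters, hlen,
      IsMirrorPower.flatMap_append_iff List.nodup_range']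
    · rw [IsMirrorPower.one_iff]
      have hz : 1 ∉ Y.reverse ++ 0 :: w.reverse := by
        simp only [List.mem_append, List.mem_cons, List.mem_reverse]
        grind
      have := exists_eq_append_reverse_iff (fun h => hX1 _ h rfl) hz
      simp only [List.append_assoc, List.cons_append] at this ⊢
      -- The palindrome condition is `Yʳ 0 wʳ = Xʳ`; reversing it gives `X = w 0 Y`.
      rw [this, ← List.reverse_inj, List.reverse_reverse, eq_comm]
      simp
    · intro d hd
      rw [List.mem_range'_1] at hd
      simp only [List.mem_append, List.mem_cons, List.mem_reverse]
      grind
  rw [containsMirrorPowers_iff]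
  constructor
  · rintro ⟨_, hmem, hmp⟩
    obtain ⟨X, Y, h, rfl⟩ := mem_grammar_language_iff.1 hmem
    exact accepts_of_trace hP0 h (fun h0 => by have := hw _ h0; omega) ((key h).1 hmp)
  · intro h
    obtain ⟨Y, hY⟩ := exists_trace_of_accepts h
    exact ⟨_, mem_grammar_language_iff.2 ⟨_, _, hY, rfl⟩, (key hY).2 rfl⟩

end LineSystem

/-! ### Simulation of stack machines by line rewriting systems -/

namespace StackMachine

open Turing Turing.PartrecToTM2 Function

/-- The letter that precedes the content of a stack. The next number follows the content. -/
def sepLetter : K' → ℕ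
  | .main => 2
  | .rev => 3
  | .aux => 4
  | .stack => 5

/-- The letter for a stack symbol. -/
def symLetter : Γ' → ℕ
  | .consₗ => 7
  | .cons => 8
  | .bit0 => 9
  | .bit1 => 10

theorem symLetter_injective : Injective symLetter := by
  intro a b
  cases a <;> cases b <;> simp [symLetter]

theorem symLetter_bounds (a : Γ') : 6 < symLetter a ∧ symLetter a < 11 := by
  cases a <;> simp [symLetter]

theorem sepLetter_bounds (k : K') : 1 < sepLetter k ∧ sepLetter k < 6 := by
  cases k <;> simp [sepLetter]

/-- All symbols of the stacks. -/
def symbols : List Γ' := [.consₗ, .cons, .bit0, .bit1]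

theorem mem_symbols (a : Γ') : a ∈ symbols := by
  cases a <;> simp [symbols]

/-- The letters of the bodies of lines. -/
def bodyLetters : List ℕ := List.range' 2 9

theorem mem_bodyLetters {a : ℕ} : a ∈ bodyLetters ↔ 2 ≤ a ∧ a < 11 := by
  simp [bodyLetters, List.mem_range'_1]

/-- The contents of the stacks as the body of a line. -/
def layout (S : K' → List Γ') : List ℕ :=
  2 :: (S .main).map symLetter ++ 3 :: (S .rev).map symLetter ++ 4 :: (S .aux).map symLetter ++
    5 :: (S .stack).map symLetter ++ [6]

theorem layout_subset (S : K' → List Γ') : layout S ⊆ bodyLetters := by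
  intro a ha
  have := symLetter_bounds
  simp only [layout, List.mem_append, List.mem_cons, List.mem_map, List.not_mem_nil] at ha
  rw [mem_bodyLetters]
  grind

/-- The surroundings `A` and `B` of stack `k` do not depend on its content `T`, and the separator of
`k` occurs only once. Hence a rule that mentions this separator applies at one place only. -/
theorem exists_layout_update (k : K') (S : K' → List Γ') :
    ∃ A B, sepLetter k ∉ A ∧ sepLetter k ∉ B ∧ ∀ T, layout (update S k T) =
      A ++ sepLetter k :: (T.map symLetter ++ (sepLetter k + 1) :: B) := by
  have h2 : ∀ a, symLetter a ≠ 2 := fun a => by have := symLetter_bounds a; omega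
  have h3 : ∀ a, symLetter a ≠ 3 := fun a => by have := symLetter_bounds a; omega
  have h4 : ∀ a, symLetter a ≠ 4 := fun a => by have := symLetter_bounds a; omega
  have h5 : ∀ a, symLetter a ≠ 5 := fun a => by have := symLetter_bounds a; omega
  cases k
  · exact ⟨[], (S .rev).map symLetter ++ 4 :: (S .aux).map symLetter ++
      5 :: (S .stack).map symLetter ++ [6], by simp, by simp [sepLetter, h2],
      fun T => by simp [layout, sepLetter, update]⟩
  · exact ⟨2 :: (S .main).map symLetter, (S .aux).map symLetter ++
      5 :: (S .stack).map symLetter ++ [6], by simp [sepLetter, h3], by simp [sepLetter, h3],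
      fun T => by simp [layout, sepLetter, update]⟩
  · exact ⟨2 :: (S .main).map symLetter ++ 3 :: (S .rev).map symLetter,
      (S .stack).map symLetter ++ [6], by simp [sepLetter, h4], by simp [sepLetter, h4],
      fun T => by simp [layout, sepLetter, update]⟩
  · exact ⟨2 :: (S .main).map symLetter ++ 3 :: (S .rev).map symLetter ++
      4 :: (S .aux).map symLetter, [], by simp [sepLetter, h5], by simp,
      fun T => by simp [layout, sepLetter, update]⟩

theorem exists_layout_eq (k : K') (S : K' → List Γ') :
    ∃ A B, ∀ T p s, layout (update S k T) = p ++ sepLetter k :: s ↔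
      p = A ∧ s = T.map symLetter ++ (sepLetter k + 1) :: B := by
  obtain ⟨A, B, hA, hB, h⟩ := exists_layout_update k S
  refine ⟨A, B, fun T p s => ?_⟩
  have hk := sepLetter_bounds k
  have hz : sepLetter k ∉ T.map symLetter ++ (sepLetter k + 1) :: B := by
    simp only [List.mem_append, List.mem_map, List.mem_cons, not_or]
    refine ⟨?_, by omega, hB⟩
    rintro ⟨a, -, ha⟩
    have := symLetter_bounds a
    omega
  rw [h, List.append_cons_inj_of_notMem hA hz]
  simp [eq_comm]

/-- `Factor S p u s`: the body for the stacks `S` is `p u s`, with body letters only. -/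
def Factor (S : K' → List Γ') (p u s : List ℕ) : Prop :=
  p ⊆ bodyLetters ∧ s ⊆ bodyLetters ∧ layout S = p ++ u ++ s

theorem factor_iff {S : K' → List Γ'} {p u s : List ℕ} :
    Factor S p u s ↔ layout S = p ++ u ++ s := by
  refine ⟨fun h => h.2.2, fun h => ?_⟩
  have := layout_subset S
  rw [h] at this
  exact ⟨fun a ha => this (by simp [ha]), fun a ha => this (by simp [ha]), h⟩

theorem push_iff {k : K'} {S : K' → List Γ'} {a : Γ'} {w : List ℕ} :
    (∃ p s, Factor S p [sepLetter k] s ∧ w = p ++ [sepLetter k, symLetter a] ++ s) ↔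
      w = layout (update S k (a :: S k)) := by
  obtain ⟨A, B, h⟩ := exists_layout_eq k S
  have hS := h (S k)
  have ha := (h (a :: S k) _ _).2 ⟨rfl, rfl⟩
  rw [update_eq_self] at hS
  simp [factor_iff, hS, ha]

/-- A stack is empty exactly when its separator is directly followed by the next one, so a rewriting
rule can test for emptiness. -/
theorem read_none_iff {k : K'} {S : K' → List Γ'} {w : List ℕ} :
    (∃ p s, Factor S p [sepLetter k, sepLetter k + 1] s ∧
      w = p ++ [sepLetter k, sepLetter k + 1] ++ s) ↔ (S k).head? = none ∧ w = layout S := by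
  obtain ⟨A, B, h⟩ := exists_layout_eq k S
  have h := h (S k)
  rw [update_eq_self] at h
  have hk := sepLetter_bounds k
  rw [List.head?_eq_none_iff]
  constructor
  · rintro ⟨p, s, hF, rfl⟩
    have hF := factor_iff.1 hF
    refine ⟨?_, hF.symm⟩
    obtain ⟨-, h2⟩ := (h p _).1 (by simpa using hF)
    rcases hS : S k with _ | ⟨b, T⟩
    · rfl
    · rw [hS] at h2
      have := symLetter_bounds b
      simp only [List.map_cons, List.cons_append, List.cons.injEq] at h2
      omega
  · rintro ⟨hS, rfl⟩
    have := (h A _).2 ⟨rfl, rfl⟩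
    rw [hS] at this
    exact ⟨A, B, factor_iff.2 (by simpa using this), by simpa using this⟩

/-- Common core of peeking and popping. On an empty stack, the letter behind the separator is at
most 6, hence not the letter of a symbol. -/
theorem factor_sym_iff {k : K'} {S : K' → List Γ'} {a : Γ'} {p s : List ℕ} :
    Factor S p [sepLetter k, symLetter a] s ↔
      (S k).head? = some a ∧ layout (update S k (S k).tail) = p ++ [sepLetter k] ++ s := by
  obtain ⟨A, B, h⟩ := exists_layout_eq k S
  have hk := sepLetter_bounds k
  have ha := symLetter_bounds a
  have h1 := h (S k) p (symLetter a :: s)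
  rw [update_eq_self] at h1
  rw [factor_iff]
  simp only [List.append_assoc, List.cons_append, List.nil_append] at h1 ⊢
  rw [h1, h]
  rcases hS : S k with _ | ⟨b, T⟩
  · simp only [List.map_nil, List.nil_append, List.cons.injEq, List.head?_nil, reduceCtorEq,
      false_and, iff_false]
    omega
  · simp [symLetter_injective.eq_iff, @eq_comm _ b a]
    tauto

theorem pop_some_iff {k : K'} {S : K' → List Γ'} {a : Γ'} {w : List ℕ} :
    (∃ p s, Factor S p [sepLetter k, symLetter a] s ∧ w = p ++ [sepLetter k] ++ s) ↔
      (S k).head? = some a ∧ w = layout (update S k (S k).tail) := by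
  simp only [factor_sym_iff]
  constructor
  · rintro ⟨p, s, ⟨h1, h2⟩, rfl⟩
    exact ⟨h1, h2.symm⟩
  · rintro ⟨h1, rfl⟩
    obtain ⟨A, B, h⟩ := exists_layout_eq k S
    have := (h (S k).tail _ _).2 ⟨rfl, rfl⟩
    exact ⟨A, _, ⟨h1, by simpa using this⟩, by simpa using this⟩

theorem peek_some_iff {k : K'} {S : K' → List Γ'} {a : Γ'} {w : List ℕ} :
    (∃ p s, Factor S p [sepLetter k, symLetter a] s ∧
      w = p ++ [sepLetter k, symLetter a] ++ s) ↔ (S k).head? = some a ∧ w = layout S := by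
  constructor
  · rintro ⟨p, s, h, rfl⟩
    exact ⟨(factor_sym_iff.1 h).1, h.2.2.symm⟩
  · rintro ⟨h1, rfl⟩
    obtain ⟨p, s, h, -⟩ := pop_some_iff.2 ⟨h1, rfl⟩
    exact ⟨p, s, h, h.2.2⟩

/-- Instructions that leave the stacks alone replace the empty factor by itself; the place is
arbitrary but does not affect the result. -/
theorem factor_nil_iff {S : K' → List Γ'} {w : List ℕ} :
    (∃ p s, Factor S p [] s ∧ w = p ++ [] ++ s) ↔ w = layout S := by
  simp only [factor_iff]
  exact ⟨fun ⟨_, _, h, hw⟩ => hw.trans h.symm, fun h => ⟨[], layout S, by simp, by simpa using h⟩⟩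

/-! #### Elementary steps -/

variable {Λ σ : Type*}

open TM2 (Stmt) in
/-- One elementary step of the execution of a statement. -/
def microStep (M : Λ → Stmt (fun _ : K' => Γ') Λ σ) :
    Stmt (fun _ : K' => Γ') Λ σ → σ → (K' → List Γ') →
      (Stmt (fun _ : K' => Γ') Λ σ × σ) × (K' → List Γ')
  | .push k f q, v, S => ((q, v), update S k (f v :: S k))
  | .peek k f q, v, S => ((q, f v (S k).head?), S)
  | .pop k f q, v, S => ((q, f v (S k).head?), update S k (S k).tail)
  | .load a q, v, S => ((q, a v), S)
  | .branch f q₁ q₂, v, S => ((cond (f v) q₁ q₂, v), S)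
  | .goto f, v, S => ((M (f v), v), S)
  | .halt, v, S => ((.halt, v), S)

variable (M : Λ → TM2.Stmt (fun _ : K' => Γ') Λ σ)
  (st : TM2.Stmt (fun _ : K' => Γ') Λ σ × σ → ℕ)

/-- The rules that read the top of the stack `k`, with new state `f o` if it is `o`; `g a` is the
replacement of the symbol `a` of the top. -/
def readRules (q : ℕ) (k : K') (f : Option Γ' → ℕ) (g : Γ' → List ℕ) :
    List (ℕ × ℕ × List ℕ × List ℕ) :=
  (q, f none, [sepLetter k, sepLetter k + 1], [sepLetter k, sepLetter k + 1]) ::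
    symbols.map fun a => (q, f (some a), [sepLetter k, symLetter a], sepLetter k :: g a)

/-- The rules for the elementary steps with a given statement and variable. -/
def stateRules : TM2.Stmt (fun _ : K' => Γ') Λ σ → σ → List (ℕ × ℕ × List ℕ × List ℕ)
  | q@(.push k f q'), v =>
    [(st (q, v), st (q', v), [sepLetter k], [sepLetter k, symLetter (f v)])]
  | q@(.peek k f q'), v =>
    readRules (st (q, v)) k (fun o => st (q', f v o)) fun a => [symLetter a]
  | q@(.pop k f q'), v => readRules (st (q, v)) k (fun o => st (q', f v o)) fun _ => []
  | q@(.load a q'), v => [(st (q, v), st (q', a v), [], [])]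
  | q@(.branch f q₁ q₂), v => [(st (q, v), st (cond (f v) q₁ q₂, v), [], [])]
  | q@(.goto f), v => [(st (q, v), st (M (f v), v), [], [])]
  | .halt, _ => []

/-- The line for a statement, a variable and the stacks. -/
def line (x : TM2.Stmt (fun _ : K' => Γ') Λ σ × σ) (S : K' → List Γ') : List ℕ :=
  st x :: layout S

variable {M st}

theorem fst_of_mem_stateRules {q : TM2.Stmt (fun _ : K' => Γ') Λ σ} {v : σ}
    {r : ℕ × ℕ × List ℕ × List ℕ} (h : r ∈ stateRules M st q v) : r.1 = st (q, v) := by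
  cases q <;> simp only [stateRules, readRules, List.mem_cons, List.mem_map, List.not_mem_nil,
    or_false] at h <;> grind

theorem sepLetter_mem (k : K') : sepLetter k ∈ bodyLetters := by
  have := sepLetter_bounds k
  rw [mem_bodyLetters]
  omega

theorem sepLetter_succ_mem (k : K') : sepLetter k + 1 ∈ bodyLetters := by
  have := sepLetter_bounds k
  rw [mem_bodyLetters]
  omega

theorem symLetter_mem (a : Γ') : symLetter a ∈ bodyLetters := by
  have := symLetter_bounds a
  rw [mem_bodyLetters]
  omega

theorem snd_of_mem_readRules {q : ℕ} {k : K'} {f : Option Γ' → ℕ} {g : Γ' → List ℕ}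
    (hg : ∀ a, g a ⊆ bodyLetters) {r : ℕ × ℕ × List ℕ × List ℕ} (h : r ∈ readRules q k f g) :
    (∃ S : K' → List Γ', r.2.1 = f (S k).head?) ∧
      r.2.2.1 ⊆ bodyLetters ∧ r.2.2.2 ⊆ bodyLetters := by
  simp only [readRules, List.mem_cons, List.mem_map] at h
  rcases h with rfl | ⟨a, -, rfl⟩
  · exact ⟨⟨fun _ => [], rfl⟩, by simp [sepLetter_mem, sepLetter_succ_mem]⟩
  · exact ⟨⟨fun _ => [a], rfl⟩, by simp [sepLetter_mem, symLetter_mem, hg]⟩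

/-- The target of every rule is realised by an elementary step on suitable stacks, so a closed set
of states contains it. -/
theorem snd_of_mem_stateRules {q : TM2.Stmt (fun _ : K' => Γ') Λ σ} {v : σ}
    {r : ℕ × ℕ × List ℕ × List ℕ} (h : r ∈ stateRules M st q v) :
    (∃ S, r.2.1 = st (microStep M q v S).1) ∧
      r.2.2.1 ⊆ bodyLetters ∧ r.2.2.2 ⊆ bodyLetters := by
  cases q with
  | peek k f q =>
    exact snd_of_mem_readRules (f := fun o => st (q, f v o)) (k := k)
      (fun a => List.cons_subset.2 ⟨symLetter_mem a, List.nil_subset _⟩) h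
  | pop k f q =>
    exact snd_of_mem_readRules (f := fun o => st (q, f v o)) (k := k)
      (fun _ => List.nil_subset _) h
  | push k f q =>
    obtain rfl := List.mem_singleton.1 h
    exact ⟨⟨fun _ => [], rfl⟩, by simp [sepLetter_mem, symLetter_mem]⟩
  | halt => simp [stateRules] at h
  | _ =>
    obtain rfl := List.mem_singleton.1 h
    exact ⟨⟨fun _ => [], rfl⟩, by simp⟩

theorem readRules_iff {q : ℕ} {k : K'} {f : Option Γ' → ℕ} {g : Γ' → List ℕ}
    {S S' : K' → List Γ'} {w : List ℕ} (hS : (S k).head? = none → S' = S)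
    (hg : ∀ a w, (∃ p s, Factor S p [sepLetter k, symLetter a] s ∧
      w = p ++ (sepLetter k :: g a) ++ s) ↔ (S k).head? = some a ∧ w = layout S') :
    (∃ r ∈ readRules q k f g, ∃ p s, Factor S p r.2.2.1 s ∧ w = r.2.1 :: (p ++ r.2.2.2 ++ s)) ↔
      w = f (S k).head? :: layout S' := by
  simp only [readRules, List.mem_cons, List.mem_map]
  constructor
  · rintro ⟨_, rfl | ⟨a, -, rfl⟩, p, s, h, rfl⟩
    · obtain ⟨h1, h2⟩ := read_none_iff.1 ⟨p, s, h, rfl⟩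
      rw [h1, hS h1, ← h2]
    · obtain ⟨h1, h2⟩ := (hg a _).1 ⟨p, s, h, rfl⟩
      rw [h1, ← h2]
  · rintro rfl
    cases h : (S k).head? with
    | none =>
      obtain ⟨p, s, h1, h2⟩ := read_none_iff.2 ⟨h, rfl⟩
      exact ⟨_, .inl rfl, p, s, h1, by rw [hS h, h2]⟩
    | some a =>
      obtain ⟨p, s, h1, h2⟩ := (hg a _).2 ⟨h, rfl⟩
      exact ⟨_, .inr ⟨a, mem_symbols a, rfl⟩, p, s, h1, by rw [h2]⟩

theorem singleton_rule_iff {q q' : ℕ} {u v : List ℕ} {S S' : K' → List Γ'} {w : List ℕ}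
    (h : ∀ w, (∃ p s, Factor S p u s ∧ w = p ++ v ++ s) ↔ w = layout S') :
    (∃ r ∈ [(q, q', u, v)], ∃ p s, Factor S p r.2.2.1 s ∧ w = r.2.1 :: (p ++ r.2.2.2 ++ s)) ↔
      w = q' :: layout S' := by
  simp only [List.mem_singleton, exists_eq_left]
  constructor
  · rintro ⟨p, s, hF, rfl⟩
    rw [← (h _).1 ⟨p, s, hF, rfl⟩]
  · rintro rfl
    obtain ⟨p, s, hF, h⟩ := (h _).2 rfl
    exact ⟨p, s, hF, by rw [h]⟩

/-- The rules for a statement and a variable perform the elementary step on lines. -/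
theorem stateRules_iff {q : TM2.Stmt (fun _ : K' => Γ') Λ σ} {v : σ} {S : K' → List Γ'}
    {w : List ℕ} :
    (∃ r ∈ stateRules M st q v, ∃ p s, Factor S p r.2.2.1 s ∧ w = r.2.1 :: (p ++ r.2.2.2 ++ s)) ↔
      q ≠ .halt ∧ w = line st (microStep M q v S).1 (microStep M q v S).2 := by
  by_cases hq : q = .halt
  · simp [hq, stateRules]
  rw [and_iff_right hq]
  cases q with
  | push k f q => exact singleton_rule_iff fun _ => push_iff
  | peek k f q =>
    exact readRules_iff (S := S) (f := fun o => st (q, f v o)) (fun _ => rfl)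
      fun _ _ => peek_some_iff
  | pop k f q =>
    refine readRules_iff (S := S) (f := fun o => st (q, f v o)) (fun h => ?_)
      fun _ _ => pop_some_iff
    -- Popping an empty stack changes nothing, because the tail of the empty list is empty.
    rw [List.head?_eq_none_iff] at h
    simp only [microStep]
    rw [h, List.tail_nil, ← h, update_eq_self]
  | halt => exact absurd rfl hq
  | _ => exact singleton_rule_iff fun _ => factor_nil_iff

/-! #### The line rewriting system of a machine -/

open scoped Classical in
/-- The line rewriting system for the given statements and variables, with names `st`. -/
noncomputable def system (M : Λ → TM2.Stmt (fun _ : K' => Γ') Λ σ)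
    (st : TM2.Stmt (fun _ : K' => Γ') Λ σ × σ → ℕ)
    (states : List (TM2.Stmt (fun _ : K' => Γ') Λ σ × σ)) : LineSystem where
  letters := bodyLetters
  rules := states.flatMap fun x => stateRules M st x.1 x.2
  finals := (states.filter fun x => x.1 = .halt).map st

/-- A set of statements and variables that is closed under elementary steps. -/
def Closed (M : Λ → TM2.Stmt (fun _ : K' => Γ') Λ σ)
    (states : List (TM2.Stmt (fun _ : K' => Γ') Λ σ × σ)) : Prop :=
  ∀ x ∈ states, ∀ S, (microStep M x.1 x.2 S).1 ∈ states

variable {states : List (TM2.Stmt (fun _ : K' => Γ') Λ σ × σ)}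

theorem letters_system {D : ℕ} (hc : Closed M states) (hD : 11 ≤ D)
    (hst : ∀ x ∈ states, 11 ≤ st x ∧ st x < D) :
    (system M st states).LettersSatisfy fun a => 2 ≤ a ∧ a < D where
  letters a ha := by
    have := mem_bodyLetters.1 ha
    omega
  finals a ha := by
    obtain ⟨x, hx, rfl⟩ := List.mem_map.1 ha
    have := hst x (List.mem_of_mem_filter hx)
    omega
  rules q q' u v h := by
    obtain ⟨x, hx, h⟩ := List.mem_flatMap.1 h
    obtain rfl : q = st x := fst_of_mem_stateRules h
    obtain ⟨⟨S, hS⟩, hu, hv⟩ := snd_of_mem_stateRules h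
    obtain rfl : q' = _ := hS
    have h1 := hst x hx
    have h2 := hst _ (hc x hx S)
    refine ⟨by omega, by omega, fun a ha => ?_, fun a ha => ?_⟩
    · have := mem_bodyLetters.1 (hu ha)
      omega
    · have := mem_bodyLetters.1 (hv ha)
      omega

/-- Injectivity of the names `st` ensures that only the rules of the state `x` itself apply to its
lines. -/
theorem step_system_iff (hst : Set.InjOn st {x | x ∈ states})
    {x : TM2.Stmt (fun _ : K' => Γ') Λ σ × σ} (hx : x ∈ states) {S : K' → List Γ'} {w : List ℕ} :
    (system M st states).Step (line st x S) w ↔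
      x.1 ≠ .halt ∧ w = line st (microStep M x.1 x.2 S).1 (microStep M x.1 x.2 S).2 := by
  rw [← stateRules_iff]
  constructor
  · rintro ⟨q, q', u, v, hr, p, s, hp, hs, h, rfl⟩
    obtain ⟨y, hy, hr⟩ := List.mem_flatMap.1 hr
    obtain ⟨rfl, hlay⟩ := List.cons.inj h
    obtain rfl := hst hx hy (fst_of_mem_stateRules hr)
    exact ⟨_, hr, p, s, ⟨hp, hs, hlay⟩, rfl⟩
  · rintro ⟨⟨q, q', u, v⟩, hr, p, s, ⟨hp, hs, hlay⟩, rfl⟩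
    obtain rfl : q = st x := fst_of_mem_stateRules hr
    exact ⟨_, _, _, _, List.mem_flatMap.2 ⟨x, hx, hr⟩, p, s, hp, hs, congrArg _ hlay, rfl⟩

/-- An elementary step only advances within `stepAux`, except that a `goto` also enters the next
machine step; neither affects halting. -/
theorem eval_microStep_dom {q : TM2.Stmt (fun _ : K' => Γ') Λ σ} {v : σ} {S : K' → List Γ'} :
    (StateTransition.eval (TM2.step M) (TM2.stepAux (microStep M q v S).1.1
      (microStep M q v S).1.2 (microStep M q v S).2)).Dom ↔
      (StateTransition.eval (TM2.step M) (TM2.stepAux q v S)).Dom := by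
  cases q with
  | branch f q₁ q₂ => cases h : f v <;> simp [microStep, h]
  | goto f =>
    have : StateTransition.Reaches (TM2.step M) ⟨some (f v), v, S⟩
      (TM2.stepAux (M (f v)) v S) := .single rfl
    rw [TM2.stepAux, StateTransition.reaches_eval this]
    rfl
  | _ => rfl

theorem eval_dom_of_accepts (hst : Set.InjOn st {x | x ∈ states}) (hc : Closed M states)
    {x : TM2.Stmt (fun _ : K' => Γ') Λ σ × σ} (hx : x ∈ states) {S : K' → List Γ'}
    (h : (system M st states).Accepts (line st x S)) :
    (StateTransition.eval (TM2.step M) (TM2.stepAux x.1 x.2 S)).Dom := by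
  obtain ⟨h, hh, s, -, hreach⟩ := h
  generalize hw : line st x S = w at hreach
  induction hreach using Relation.ReflTransGen.head_induction_on generalizing x S with
  | refl =>
    obtain ⟨y, hy, rfl⟩ := List.mem_map.1 hh
    obtain ⟨hy, hhalt⟩ := List.mem_filter.1 hy
    obtain rfl := hst hx hy (List.cons.inj hw).1
    rw [show x.1 = .halt by simpa using hhalt]
    exact Part.dom_iff_mem.2 ⟨_, StateTransition.mem_eval.2 ⟨.refl, rfl⟩⟩
  | head hstep _ ih =>
    subst hw
    obtain ⟨-, rfl⟩ := (step_system_iff hst hx).1 hstep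
    exact eval_microStep_dom.1 (ih (hc x hx S) rfl)

/-- One machine step unfolds into elementary steps, by induction on the statement, until it halts or
jumps to a label `l`; the hypothesis takes over at `M l`. -/
theorem accepts_of_stepAux (hst : Set.InjOn st {x | x ∈ states}) (hc : Closed M states)
    {q : TM2.Stmt (fun _ : K' => Γ') Λ σ} {v : σ} {S : K' → List Γ'} (hq : (q, v) ∈ states)
    (h : ∀ l v' S', TM2.stepAux q v S = ⟨some l, v', S'⟩ → (M l, v') ∈ states →
      (system M st states).Accepts (line st (M l, v') S')) :
    (system M st states).Accepts (line st (q, v) S) := by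
  have accepts_step : ∀ {q v S}, (q, v) ∈ states → q ≠ .halt →
      (system M st states).Accepts (line st (microStep M q v S).1 (microStep M q v S).2) →
      (system M st states).Accepts (line st (q, v) S) := by
    rintro q v S hq hne ⟨h, hh, s, hs, hreach⟩
    exact ⟨h, hh, s, hs, .head ((step_system_iff hst hq).2 ⟨hne, rfl⟩) hreach⟩
  induction q generalizing v S with
  | halt =>
    exact ⟨_, List.mem_map_of_mem (List.mem_filter.2 ⟨hq, by simp⟩), _, layout_subset S, .refl⟩
  | goto f => exact accepts_step hq (by simp) (h _ _ _ rfl (hc _ hq S))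
  | branch f q₁ q₂ ih₁ ih₂ =>
    have hmem := hc _ hq S
    refine accepts_step hq (by simp) ?_
    simp only [microStep, TM2.stepAux] at hmem h ⊢
    cases hf : f v <;> rw [hf] at hmem h
    · exact ih₂ hmem h
    · exact ih₁ hmem h
  | push k f q ih => exact accepts_step hq (by simp) (ih (hc _ hq S) h)
  | peek k f q ih => exact accepts_step hq (by simp) (ih (hc _ hq S) h)
  | pop k f q ih => exact accepts_step hq (by simp) (ih (hc _ hq S) h)
  | load a q ih => exact accepts_step hq (by simp) (ih (hc _ hq S) h)

theorem accepts_of_eval_dom (hst : Set.InjOn st {x | x ∈ states}) (hc : Closed M states)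
    {x : TM2.Stmt (fun _ : K' => Γ') Λ σ × σ} (hx : x ∈ states) {S : K' → List Γ'}
    (h : (StateTransition.eval (TM2.step M) (TM2.stepAux x.1 x.2 S)).Dom) :
    (system M st states).Accepts (line st x S) := by
  obtain ⟨b, hmem⟩ := Part.dom_iff_mem.1 h
  obtain ⟨hreach, hb⟩ := StateTransition.mem_eval.1 hmem
  generalize hcfg : TM2.stepAux x.1 x.2 S = c at hreach
  clear h hmem
  induction hreach using Relation.ReflTransGen.head_induction_on generalizing x S with
  | refl =>
    refine accepts_of_stepAux hst hc hx fun l v' S' h _ => ?_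
    rw [← hcfg, h] at hb
    -- A configuration that still has a label can make a step, so it does not end the run.
    cases hb
  | head hstep _ ih =>
    refine accepts_of_stepAux hst hc hx fun l v' S' h hmem => ih (x := (M l, v')) hmem ?_
    rw [← hcfg, h] at hstep
    exact Option.some.inj hstep

theorem accepts_iff_eval_dom (hst : Set.InjOn st {x | x ∈ states}) (hc : Closed M states)
    {l : Λ} {v : σ} (hx : (M l, v) ∈ states) {S : K' → List Γ'} :
    (system M st states).Accepts (line st (M l, v) S) ↔
      (StateTransition.eval (TM2.step M) ⟨some l, v, S⟩).Dom := by
  have : StateTransition.Reaches (TM2.step M) ⟨some l, v, S⟩ (TM2.stepAux (M l) v S) :=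
    .single rfl
  rw [StateTransition.reaches_eval this]
  exact ⟨eval_dom_of_accepts hst hc hx, accepts_of_eval_dom hst hc hx⟩

/-- The statements that occur in the code of supported labels are closed under passing to
substatements and under jumps; they are paired with all values of the finite variable. -/
theorem exists_closed [Fintype σ] [Inhabited Λ] {T : Finset Λ} (hT : TM2.Supports M T) :
    ∃ states, Closed M states ∧ ∀ v, (M default, v) ∈ states := by
  classical
  let states : Finset (TM2.Stmt (fun _ : K' => Γ') Λ σ × σ) :=
    Finset.eraseNone (TM2.stmts M T) ×ˢ Finset.univ
  have hmem : ∀ x, x ∈ states.toList ↔ some x.1 ∈ TM2.stmts M T := by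
    simp [states]
  have hlabel : ∀ l ∈ T, some (M l) ∈ TM2.stmts M T := fun l hl =>
    Finset.some_mem_insertNone.2 (Finset.mem_biUnion.2 ⟨l, hl, TM2.stmts₁_self⟩)
  refine ⟨states.toList, ?_, fun v => (hmem _).2 (hlabel _ hT.1)⟩
  rintro ⟨q, v⟩ hx S
  rw [hmem] at hx ⊢
  have hsub : ∀ q' ∈ TM2.stmts₁ q, some q' ∈ TM2.stmts M T := fun q' h =>
    TM2.stmts_trans h hx
  cases q with
  | goto f => exact hlabel _ (TM2.stmts_supportsStmt hT hx v)
  | halt => exact hx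
  | branch f q₁ q₂ =>
    refine hsub _ ?_
    simp only [microStep, TM2.stmts₁, Finset.mem_insert, Finset.mem_union]
    cases f v
    · exact .inr (.inr TM2.stmts₁_self)
    · exact .inr (.inl TM2.stmts₁_self)
  | _ =>
    refine hsub _ ?_
    simp only [microStep, TM2.stmts₁, Finset.mem_insert]
    exact .inr TM2.stmts₁_self

end StackMachine

/-! ### A universal machine and the reduction from the halting problem -/

namespace StackMachine

open Turing Turing.PartrecToTM2 Function

/-- Numerals start with the least significant bit. Inputs that are powers of two make the initial
line a block of `n` equal letters with fixed surroundings, which is evidently primitive recursive in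
`n`. -/
theorem trNat_two_pow (n : ℕ) : trNat (2 ^ n) = List.replicate n Γ'.bit0 ++ [Γ'.bit1] := by
  have h : ((2 ^ n : ℕ) : Num) = Num.pos (PosNum.bit0^[n] 1) := by
    induction n with
    | zero => rfl
    | succ n ih =>
      rw [pow_succ, Nat.cast_mul, ih, iterate_succ_apply', Nat.cast_two, mul_two]
      change Num.pos _ = _
      exact (congrArg Num.pos (PosNum.bit0_of_bit0 _))
  rw [trNat, h]
  simp only [trNum]
  clear h
  induction n with
  | zero => rfl
  | succ n ih => rw [iterate_succ_apply', trPosNum, ih]; rfl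

/-- Halting of all programs is captured by one code, applied to powers of two. -/
theorem exists_universal_code : ∃ c : ToPartrec.Code, ∀ n : ℕ,
    (c.eval [2 ^ n]).Dom ↔ (Nat.Partrec.Code.eval (Denumerable.ofNat _ n) 0).Dom := by
  -- Recover the exponent `i` of `m = 2 ^ i` by search, then run program number `i` on input 0.
  let f : ℕ →. ℕ := fun m => (Nat.rfind fun i => Part.some (decide (2 ^ i = m))).bind
    fun n => Nat.Partrec.Code.eval (Denumerable.ofNat _ n) 0
  have hpow : Primrec fun i : ℕ => 2 ^ i :=
    (Primrec.nat_rec₁ 1 (Primrec.nat_mul.comp (Primrec.const 2) Primrec.snd).to₂).of_eq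
      fun i => by induction i with
        | zero => rfl
        | succ i ih => rw [pow_succ', ← ih]
  have hdec : Computable₂ fun m i : ℕ => decide (2 ^ i = m) :=
    (Primrec.eq.comp (hpow.comp Primrec.snd) Primrec.fst).decide.to_comp.to₂
  have hf : Partrec f := by
    refine (Partrec.rfind (p := fun m i => Part.some (decide (2 ^ i = m))) hdec).bind ?_
    exact (Nat.Partrec.Code.eval_part.comp ((Computable.ofNat _).comp Computable.snd)
      (Computable.const 0)).to₂
  obtain ⟨c, hc⟩ := ToPartrec.Code.exists_code (Nat.Partrec'.part_iff₁.2 hf)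
  refine ⟨c, fun n => ?_⟩
  have hn : (Nat.rfind fun i => Part.some (decide (2 ^ i = 2 ^ n))) = Part.some n := by
    refine Part.eq_some_iff.2 (Nat.mem_rfind.2 ⟨by simp, fun {m} hm => ?_⟩)
    simp [hm.ne]
  have := hc (2 ^ n ::ᵥ List.Vector.nil)
  rw [show [2 ^ n] = (2 ^ n ::ᵥ List.Vector.nil : List.Vector ℕ 1).1 from rfl, this]
  have hfn : f (2 ^ n) = Nat.Partrec.Code.eval (Denumerable.ofNat _ n) 0 := by
    simp only [f]
    rw [hn, Part.bind_some]
  rw [List.Vector.head_cons, hfn]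
  rfl

/-- The initial line for the input `2 ^ n`, without its state letter. -/
def inputLayout (n : ℕ) : List ℕ := 2 :: (List.replicate n 9 ++ [10, 8, 3, 4, 5, 6])

theorem layout_input (n : ℕ) :
    layout (K'.elim (trList [2 ^ n]) [] [] []) = inputLayout n := by
  simp [layout, inputLayout, trNat_two_pow, symLetter]

theorem primrec_replicate (a : ℕ) : Primrec fun n : ℕ => List.replicate n a :=
  (Primrec.list_map Primrec.list_range (Primrec.const a).to₂).of_eq fun n => by simp

theorem exists_universal_system : ∃ (R : LineSystem) (D s : ℕ), 2 ≤ D ∧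
    R.LettersSatisfy (fun a => 2 ≤ a ∧ a < D) ∧
    (∀ n, ∀ a ∈ s :: inputLayout n, 2 ≤ a ∧ a < D) ∧
    ∀ n, R.Accepts (s :: inputLayout n) ↔
      (Nat.Partrec.Code.eval (Denumerable.ofNat _ n) 0).Dom := by
  classical
  obtain ⟨c, hc⟩ := exists_universal_code
  let l := trNormal c Cont'.halt
  -- `TM2.Supports` takes the default label as the entry point, so the default has to be the start
  -- label of `c`.
  let _ : Inhabited Λ' := ⟨l⟩
  let M : Λ' → TM2.Stmt (fun _ : K' => Γ') Λ' (Option Γ') := tr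
  obtain ⟨states, hclosed, hinit⟩ := exists_closed (M := M) (tr_supports c Cont'.halt)
  let st : TM2.Stmt (fun _ : K' => Γ') Λ' (Option Γ') × Option Γ' → ℕ :=
    -- The letters 2 to 10 are used in bodies of lines; state letters start at 11.
    fun x => 11 + states.idxOf x
  have hst : Set.InjOn st {x | x ∈ states} := fun x hx y _ h =>
    (List.idxOf_inj hx).1 (Nat.add_left_cancel h)
  have hbound : ∀ x ∈ states, 11 ≤ st x ∧ st x < 11 + states.length := fun x hx => by
    have := List.idxOf_lt_length_of_mem hx
    simp only [st]
    omega
  have hmem : (M l, none) ∈ states := hinit none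
  refine ⟨system M st states, 11 + states.length, st (M l, none), by omega,
    letters_system hclosed (by omega) hbound, fun n a ha => ?_, fun n => ?_⟩
  · have := hbound _ hmem
    rw [← layout_input] at ha
    rcases List.mem_cons.1 ha with rfl | ha
    · omega
    · have := mem_bodyLetters.1 (layout_subset _ ha)
      omega
  · rw [← layout_input, ← hc n]
    refine (accepts_iff_eval_dom hst hclosed hmem).trans ?_
    have h := tr_eval c [2 ^ n]
    change (StateTransition.eval (TM2.step tr) (init c [2 ^ n])).Dom ↔ _
    rw [h]
    rfl

end StackMachine

/-- Only the right context in the start production varies with the input; all other productions are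
constant. -/
theorem LineSystem.computable_grammar (R : LineSystem) (x : List ℕ) {f : ℕ → List ℕ}
    (hf : Computable f) : Computable fun n => R.grammar x (f n) := by
  have h1 : Computable fun n => (f n).map (Sum.inl (β := ℕ)) :=
    (Primrec.list_map Primrec.id (Primrec.sumInl.comp Primrec.snd).to₂).to_comp.comp hf
  have h2 : Computable fun n => x.map Sum.inl ++ Sum.inr 0 :: (f n).map (Sum.inl (β := ℕ)) :=
    Computable.list_append.comp (Computable.const _)
      (Computable.list_cons.comp (Computable.const _) h1)
  exact (Computable.const 3).pair
    (Computable.list_cons.comp ((Computable.const 3).pair h2) (Computable.const _))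

/-- For each fixed `k ≥ 1`, no algorithm decides, given a context-free grammar, whether its
language contains a word `w₁ w₁ʳ ⋯ wₖ wₖʳ`. -/
theorem theorem4p15 (k : ℕ) (hk : 1 ≤ k) :
    ¬ ComputablePred (fun G : CFGCode => ContainsMirrorPowers k G.language) := by
  obtain ⟨k, rfl⟩ := Nat.exists_eq_add_of_le' hk
  obtain ⟨R, D, s, hD, hR, hs, hacc⟩ := StackMachine.exists_universal_system
  intro h
  refine ComputablePred.halting_problem 0 (ComputablePred.computable_of_manyOneReducible
    ⟨fun c => R.grammar (LineSystem.doubledLetters D k)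
      (0 :: (s :: StackMachine.inputLayout (Encodable.encode c)).reverse), ?_, fun c => ?_⟩ h)
  · have hin : Primrec fun n => 0 :: (s :: StackMachine.inputLayout n).reverse :=
      Primrec.list_cons.comp (Primrec.const 0) (Primrec.list_reverse.comp
        (Primrec.list_cons.comp (Primrec.const s) (Primrec.list_cons.comp (Primrec.const 2)
          (Primrec.list_append.comp (StackMachine.primrec_replicate 9) (Primrec.const _)))))
    exact (R.computable_grammar _ hin.to_comp).comp Computable.encode
  · rw [LineSystem.containsMirrorPowers_grammar_iff hR hD (hs _), hacc, Denumerable.ofNat_encode]
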